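/- Let $d\ge 1$, $1\le p<\infty$, and let $\nu:\mathbb R^d\setminus\{0\}\to[0,\infty]$ be measurable. Let $c_d=|B(0,1)|$, $\eta(r)=(r/c_d)^{1/d}$, let $$\nu^*(\rho)=\inf\{s>0:\ |\{\nu>s\}|\le c_d\rho^d\}$$ be the symmetric rearrangement of $\nu$ as a function of the radius $\rho$, let $\nu^\#(r)=\int_{\{\nu<\nu^*(\eta(r))\}}\nu(h)\,dh$, and let $w(r)=(r\,\nu^\#(r))^{1/p}$ for $0<r<\infty$, $w(0)=0$, $w(\infty)=\infty$. Assume that $w:[0,\infty]\to[0,\infty]$ is bijective and let $\phi(t)=1/w^{-1}(1/t)$, $t\in[0,\infty]$. Assume that $t\mapsto\phi(t^{1/p})$ is a Young function, i.e. a convex function $[0,\infty]\to[0,\infty]$ vanishing at $0$, and that there is $\theta>0$ with $$\phi\Big(\theta\,\frac st\Big)\le\frac{\phi(s)}{\phi(t)}\qquad\text{for all } 0\le s\le t,\ 0<t<\infty.$$ For measurable $\Omega\subset\mathbb R^d$ put $$|u|_{W^p_\nu(\Omega)}=\Big(\int_\Omega\int_\Omega|u(x)-u(y)|^p\,\nu(x-y)\,dy\,dx\Big)^{1/p}\in[0,\infty],$$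 $W^p_\nu(\Omega)=\{u\in L^p(\Omega):|u|_{W^p_\nu(\Omega)}<\infty\}$ and $\|u\|_{W^p_\nu(\Omega)}=(\|u\|_{L^p(\Omega)}^p+|u|_{W^p_\nu(\Omega)}^p)^{1/p}$. Let $L^\phi(\Omega)$ be the space of measurable $u:\Omega\to\mathbb R$ with $\int_\Omega\phi(|u|/\lambda)\,dx<\infty$ for some $\lambda>0$, with the Luxemburg norm $\|u\|_{L^\phi(\Omega)}=\inf\{\lambda>0:\int_\Omega\phi(|u|/\lambda)\,dx\le1\}$. An open set $\Omega$ is a $W^p_\nu$-extension domain if there are a linear operator $E:W^p_\nu(\Omega)\to W^p_\nu(\mathbb R^d)$ and a constant $C$ with $Eu=u$ a.e. on $\Omega$ and $\|Eu\|_{W^p_\nu(\mathbb R^d)}\le C\|u\|_{W^p_\nu(\Omega)}$ for all $u\in W^p_\nu(\Omega)$. Let $\Omega\subset\mathbb R^d$ be measurable with $0<|\Omega|<\infty$, and write $u_\Omega=|\Omega|^{-1}\int_\Omega u\,dx$. 1. If the Poincaré–Sobolev inequality holds on $\Omega$, i.e. there is a constant $C>0$ with $$\big\|u-u_\Omega\big\|_{L^\phi(\Omega)}\le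 C\,|u|_{W^p_\nu(\Omega)}\qquad\text{for all }u\in L^\phi(\Omega),$$ then the Poincaré inequality holds on $\Omega$, i.e. there is a constant $C>0$ with $$\big\|u-u_\Omega\big\|_{L^p(\Omega)}\le C\,|u|_{W^p_\nu(\Omega)}\qquad\text{for all }u\in L^p(\Omega).$$ 2. If in addition $\Omega$ is a $W^p_\nu$-extension domain, then conversely the Poincaré inequality on $\Omega$ implies the Poincaré–Sobolev inequality on $\Omega$ (with a possibly different constant). -/

import Mathlib

open MeasureTheory Set
open scoped ENNReal NNReal

noncomputable section

namespace NonlocalSobolev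

/-! ### The kernel: rearrangement and critical function

A kernel is a function `ν : ℝ^d → [0,∞]`; its value at the origin, a null set, plays no role. -/

section Kernel

variable {d : ℕ}

/-- The volume `c_d = |B(0,1)|` of the unit ball of `ℝ^d`. -/
def unitBallVolume (d : ℕ) : ℝ≥0∞ :=
  volume (Metric.ball (0 : EuclideanSpace ℝ (Fin d)) 1)

/-- `η(r) = (r / c_d)^{1/d}`, the radius of the ball of volume `r`. -/
def ballRadius (d : ℕ) (r : ℝ≥0∞) : ℝ≥0∞ :=
  (r / unitBallVolume d) ^ (1 / (d : ℝ))

/-- The symmetric rearrangement `ν^*` of `ν`, as a function of the radius `ρ = |x|`: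
`ν^*(ρ) = inf {s > 0 : |{ν > s}| ≤ c_d ρ^d}`. -/
def symmRearrangement (ν : EuclideanSpace ℝ (Fin d) → ℝ≥0∞) (ρ : ℝ≥0∞) : ℝ≥0∞ :=
  sInf {s : ℝ≥0∞ | 0 < s ∧ volume {h | s < ν h} ≤ unitBallVolume d * ρ ^ d}

/-- `ν^#(r) = ∫_{ν < ν^*(η(r))} ν(h) dh`. -/
def nuSharp (ν : EuclideanSpace ℝ (Fin d) → ℝ≥0∞) (r : ℝ≥0∞) : ℝ≥0∞ :=
  ∫⁻ h in {h | ν h < symmRearrangement ν (ballRadius d r)}, ν h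

/-- `w(r) = (r ν^#(r))^{1/p}` on `[0,∞]`. At the endpoints `w(0) = 0` (from `0 · a = 0`) and
`w(∞) = ∞`, where the formula has the indeterminate form `∞ · 0`. -/
def wFun (ν : EuclideanSpace ℝ (Fin d) → ℝ≥0∞) (p : ℝ) (r : ℝ≥0∞) : ℝ≥0∞ :=
  if r = ∞ then ∞ else (r * nuSharp ν r) ^ (1 / p)

/-- The critical function `φ(t) = 1 / w⁻¹(1/t)`, meaningful when `w` is invertible. -/
def criticalFun (ν : EuclideanSpace ℝ (Fin d) → ℝ≥0∞) (p : ℝ) (t : ℝ≥0∞) : ℝ≥0∞ :=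
  (Function.invFun (wFun ν p) t⁻¹)⁻¹

/-- A Young function: a convex function `ψ : [0,∞] → [0,∞]` with `ψ(0) = 0`. -/
structure IsYoung (ψ : ℝ≥0∞ → ℝ≥0∞) : Prop where
  convexOn : ConvexOn ℝ≥0 univ ψ
  map_zero : ψ 0 = 0

/-- The hypotheses on the kernel: `ν` is measurable, `w` is invertible from `[0,∞]` to `[0,∞]`,
`t ↦ φ(t^{1/p})` is a Young function, and for some `θ > 0` the growth condition
`φ(θ s / t) ≤ φ(s) / φ(t)` holds for `0 ≤ s ≤ t`, `0 < t < ∞`. -/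
structure IsAdmissibleKernel (ν : EuclideanSpace ℝ (Fin d) → ℝ≥0∞) (p : ℝ) : Prop where
  measurable : Measurable ν
  bijective : Function.Bijective (wFun ν p)
  young : IsYoung (fun t => criticalFun ν p (t ^ (1 / p)))
  growth : ∃ θ : ℝ≥0, 0 < θ ∧ ∀ s t : ℝ≥0∞, 0 < t → t ≠ ∞ → s ≤ t →
    criticalFun ν p (θ * (s / t)) ≤ criticalFun ν p s / criticalFun ν p t

end Kernel

/-! ### Orlicz spaces -/

section Orlicz

variable {d : ℕ}

/-- `u ∈ L^φ(Ω)`: `u` is measurable on `Ω` and `∫_Ω φ(|u|/l) < ∞` for some `l > 0`. -/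
def MemOrlicz (φ : ℝ≥0∞ → ℝ≥0∞) (Ω : Set (EuclideanSpace ℝ (Fin d)))
    (u : EuclideanSpace ℝ (Fin d) → ℝ) : Prop :=
  AEMeasurable u (volume.restrict Ω) ∧
    ∃ l : ℝ≥0, 0 < l ∧ ∫⁻ x in Ω, φ (‖u x‖ₑ / l) < ∞

/-- The Luxemburg norm `inf {l > 0 : ∫_Ω φ(|u|/l) ≤ 1}`, equal to `∞` if there is no such `l`. -/
def luxNorm (φ : ℝ≥0∞ → ℝ≥0∞) (Ω : Set (EuclideanSpace ℝ (Fin d)))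
    (u : EuclideanSpace ℝ (Fin d) → ℝ) : ℝ≥0∞ :=
  ⨅ (l : ℝ≥0) (_ : 0 < l ∧ ∫⁻ x in Ω, φ (‖u x‖ₑ / l) ≤ 1), (l : ℝ≥0∞)

end Orlicz

/-! ### Nonlocal Sobolev spaces -/

section Sobolev

variable {d : ℕ}

/-- The energy `∫_Ω ∫_Ω |u(x) - u(y)|^p ν(x - y) dy dx`. -/
def nlEnergy (ν : EuclideanSpace ℝ (Fin d) → ℝ≥0∞) (p : ℝ) (Ω : Set (EuclideanSpace ℝ (Fin d)))
    (u : EuclideanSpace ℝ (Fin d) → ℝ) : ℝ≥0∞ :=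
  ∫⁻ x in Ω, ∫⁻ y in Ω, ‖u x - u y‖ₑ ^ p * ν (x - y)

/-- The seminorm `|u|_{W^p_ν(Ω)}`, with values in `[0,∞]`. -/
def nlSeminorm (ν : EuclideanSpace ℝ (Fin d) → ℝ≥0∞) (p : ℝ)
    (Ω : Set (EuclideanSpace ℝ (Fin d))) (u : EuclideanSpace ℝ (Fin d) → ℝ) : ℝ≥0∞ :=
  nlEnergy ν p Ω u ^ (1 / p)

/-- The norm `‖u‖_{W^p_ν(Ω)} = (‖u‖_{L^p(Ω)}^p + |u|_{W^p_ν(Ω)}^p)^{1/p}`. -/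
def nlNorm (ν : EuclideanSpace ℝ (Fin d) → ℝ≥0∞) (p : ℝ) (Ω : Set (EuclideanSpace ℝ (Fin d)))
    (u : EuclideanSpace ℝ (Fin d) → ℝ) : ℝ≥0∞ :=
  (eLpNorm u (ENNReal.ofReal p) (volume.restrict Ω) ^ p + nlSeminorm ν p Ω u ^ p) ^ (1 / p)

lemma nlEnergy_congr (ν : EuclideanSpace ℝ (Fin d) → ℝ≥0∞) (p : ℝ)
    (Ω : Set (EuclideanSpace ℝ (Fin d))) {u v : EuclideanSpace ℝ (Fin d) → ℝ}
    (h : u =ᵐ[volume.restrict Ω] v) : nlEnergy ν p Ω u = nlEnergy ν p Ω v := by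
  unfold nlEnergy
  refine lintegral_congr_ae ?_
  filter_upwards [h] with x hx
  refine lintegral_congr_ae ?_
  filter_upwards [h] with y hy
  rw [hx, hy]

lemma nlEnergy_add_lt_top {ν : EuclideanSpace ℝ (Fin d) → ℝ≥0∞} (hν : Measurable ν) {p : ℝ}
    (hp : 1 ≤ p) (Ω : Set (EuclideanSpace ℝ (Fin d))) {u v : EuclideanSpace ℝ (Fin d) → ℝ}
    (hu : Measurable u) (hu' : nlEnergy ν p Ω u < ∞) (hv' : nlEnergy ν p Ω v < ∞) :
    nlEnergy ν p Ω (u + v) < ∞ := by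
  have hm : Measurable (fun z : EuclideanSpace ℝ (Fin d) × EuclideanSpace ℝ (Fin d) =>
      ‖u z.1 - u z.2‖ₑ ^ p * ν (z.1 - z.2)) := by fun_prop
  have key : nlEnergy ν p Ω (u + v)
      ≤ (2 : ℝ≥0∞) ^ (p - 1) * (nlEnergy ν p Ω u + nlEnergy ν p Ω v) := by
    have h2 : (2 : ℝ≥0∞) ^ (p - 1) ≠ ∞ := by
      exact ENNReal.rpow_ne_top_of_nonneg (by linarith) (by simp)
    unfold nlEnergy
    rw [← lintegral_add_left hm.lintegral_prod_right', ← lintegral_const_mul' _ _ h2]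
    refine lintegral_mono fun x => ?_
    have hx : Measurable (fun y => ‖u x - u y‖ₑ ^ p * ν (x - y)) := by fun_prop
    simp only
    rw [← lintegral_add_left hx, ← lintegral_const_mul' _ _ h2]
    refine lintegral_mono fun y => ?_
    have h1 : ‖(u + v) x - (u + v) y‖ₑ ≤ ‖u x - u y‖ₑ + ‖v x - v y‖ₑ := by
      have : (u + v) x - (u + v) y = (u x - u y) + (v x - v y) := by
        simp only [Pi.add_apply]; ring
      rw [this]; exact enorm_add_le _ _
    have h3 := (ENNReal.rpow_le_rpow h1 (by linarith : (0 : ℝ) ≤ p)).trans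
      (ENNReal.rpow_add_le_mul_rpow_add_rpow _ _ hp)
    calc _ ≤ (2 ^ (p - 1) * (‖u x - u y‖ₑ ^ p + ‖v x - v y‖ₑ ^ p)) * ν (x - y) := by gcongr
      _ = _ := by ring
  refine key.trans_lt (ENNReal.mul_lt_top ?_ (ENNReal.add_lt_top.2 ⟨hu', hv'⟩))
  exact ENNReal.rpow_lt_top_of_nonneg (by linarith) (by simp)

lemma nlEnergy_smul {ν : EuclideanSpace ℝ (Fin d) → ℝ≥0∞} {p : ℝ} (hp : 1 ≤ p)
    (Ω : Set (EuclideanSpace ℝ (Fin d))) (c : ℝ) (u : EuclideanSpace ℝ (Fin d) → ℝ) :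
    nlEnergy ν p Ω (c • u) = ‖c‖ₑ ^ p * nlEnergy ν p Ω u := by
  have hc : ‖c‖ₑ ^ p ≠ ∞ := ENNReal.rpow_ne_top_of_nonneg (by linarith) (by simp)
  unfold nlEnergy
  rw [← lintegral_const_mul' _ _ hc]
  refine lintegral_congr fun x => ?_
  rw [← lintegral_const_mul' _ _ hc]
  refine lintegral_congr fun y => ?_
  have : (c • u) x - (c • u) y = c * (u x - u y) := by
    simp only [Pi.smul_apply, smul_eq_mul]; ring
  rw [this, enorm_mul, ENNReal.mul_rpow_of_nonneg _ _ (by linarith), mul_assoc]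

/-- The nonlocal Sobolev space `W^p_ν(Ω) = {u ∈ L^p(Ω) : |u|_{W^p_ν(Ω)} < ∞}`, as a subspace of
`L^p(Ω)`. -/
def nlSobolev (ν : EuclideanSpace ℝ (Fin d) → ℝ≥0∞) (hν : Measurable ν) (p : ℝ) (hp : 1 ≤ p)
    (Ω : Set (EuclideanSpace ℝ (Fin d))) :
    Submodule ℝ (Lp ℝ (ENNReal.ofReal p) (volume.restrict Ω)) where
  carrier := {u | nlSeminorm ν p Ω u < ∞}
  zero_mem' := by
    have h0 : nlEnergy ν p Ω (0 : Lp ℝ (ENNReal.ofReal p) (volume.restrict Ω)) = 0 := by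
      rw [nlEnergy_congr ν p Ω (Lp.coeFn_zero ℝ (ENNReal.ofReal p) (volume.restrict Ω))]
      simp [nlEnergy, ENNReal.zero_rpow_of_pos (show 0 < p by linarith)]
    have h1 : nlSeminorm ν p Ω (0 : Lp ℝ (ENNReal.ofReal p) (volume.restrict Ω)) < ∞ := by
      rw [nlSeminorm, h0]
      exact ENNReal.rpow_lt_top_of_nonneg (by positivity) (by simp)
    exact h1
  add_mem' := by
    intro u v hu hv
    simp only [mem_ofPred_eq, nlSeminorm,
      ENNReal.rpow_lt_top_iff_of_pos (show 0 < 1 / p by positivity)] at hu hv ⊢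
    rw [nlEnergy_congr ν p Ω (Lp.coeFn_add u v)]
    exact nlEnergy_add_lt_top hν hp Ω (Lp.stronglyMeasurable u).measurable hu hv
  smul_mem' := by
    intro c u hu
    simp only [mem_ofPred_eq, nlSeminorm,
      ENNReal.rpow_lt_top_iff_of_pos (show 0 < 1 / p by positivity)] at hu ⊢
    rw [nlEnergy_congr ν p Ω (Lp.coeFn_smul c u), nlEnergy_smul hp]
    exact ENNReal.mul_lt_top (ENNReal.rpow_lt_top_of_nonneg (by linarith) (by simp)) hu

/-- `Ω` is a `W^p_ν`-extension domain: it is open and there are a linear operator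
`E : W^p_ν(Ω) → W^p_ν(ℝ^d)` and a constant `C` with `Eu = u` a.e. on `Ω` and
`‖Eu‖_{W^p_ν(ℝ^d)} ≤ C ‖u‖_{W^p_ν(Ω)}`. -/
def IsExtensionDomain (ν : EuclideanSpace ℝ (Fin d) → ℝ≥0∞) (hν : Measurable ν) (p : ℝ)
    (hp : 1 ≤ p) (Ω : Set (EuclideanSpace ℝ (Fin d))) : Prop :=
  IsOpen Ω ∧ ∃ (E : nlSobolev ν hν p hp Ω →ₗ[ℝ] nlSobolev ν hν p hp univ) (C : ℝ≥0),
    ∀ u : nlSobolev ν hν p hp Ω,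
      ((E u : Lp ℝ (ENNReal.ofReal p) (volume.restrict univ)) : EuclideanSpace ℝ (Fin d) → ℝ)
        =ᵐ[volume.restrict Ω]
        ((u : Lp ℝ (ENNReal.ofReal p) (volume.restrict Ω)) : EuclideanSpace ℝ (Fin d) → ℝ) ∧
      nlNorm ν p univ (E u : Lp ℝ (ENNReal.ofReal p) (volume.restrict univ)) ≤
        C * nlNorm ν p Ω (u : Lp ℝ (ENNReal.ofReal p) (volume.restrict Ω))

/-! ### The two inequalities -/

/-- The Poincaré–Sobolev inequality on `Ω`: for some constant `C > 0`,
`‖u - ⨍_Ω u‖_{L^φ(Ω)} ≤ C |u|_{W^p_ν(Ω)}` for all `u ∈ L^φ(Ω)`, with `φ` the critical function. -/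
def PoincareSobolev (ν : EuclideanSpace ℝ (Fin d) → ℝ≥0∞) (p : ℝ)
    (Ω : Set (EuclideanSpace ℝ (Fin d))) : Prop :=
  ∃ C : ℝ≥0, 0 < C ∧ ∀ u : EuclideanSpace ℝ (Fin d) → ℝ, MemOrlicz (criticalFun ν p) Ω u →
    luxNorm (criticalFun ν p) Ω (fun x => u x - ⨍ y in Ω, u y) ≤ C * nlSeminorm ν p Ω u

/-- The Poincaré inequality on `Ω`: for some constant `C > 0`,
`‖u - ⨍_Ω u‖_{L^p(Ω)} ≤ C |u|_{W^p_ν(Ω)}` for all `u ∈ L^p(Ω)`. -/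
def Poincare (ν : EuclideanSpace ℝ (Fin d) → ℝ≥0∞) (p : ℝ)
    (Ω : Set (EuclideanSpace ℝ (Fin d))) : Prop :=
  ∃ C : ℝ≥0, 0 < C ∧ ∀ u : EuclideanSpace ℝ (Fin d) → ℝ,
    MemLp u (ENNReal.ofReal p) (volume.restrict Ω) →
    eLpNorm (fun x => u x - ⨍ y in Ω, u y) (ENNReal.ofReal p) (volume.restrict Ω) ≤
      C * nlSeminorm ν p Ω u

end Sobolev

end NonlocalSobolev

end

namespace NonlocalSobolev

/-! ### Rearrangement of the kernel and properties of `w` and `φ` -/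

section Kernel

variable {d : ℕ} {ν : EuclideanSpace ℝ (Fin d) → ℝ≥0∞} {p : ℝ}

/-! Convexity of `t ↦ φ(t^{1/p})` gives `t^p ≤ 1 + φ(t)/φ(1)`, so on a set of finite measure the
Luxemburg norm controls the `L^p` norm (`eLpNorm_le_luxNorm`). This yields the first implication for
bounded functions. Truncation does not increase the seminorm, and Fatou's lemma extends the bound to
all of `L^p`.

The converse rests on the Sobolev inequality on `ℝ^d` (`exists_luxNorm_le_nlSeminorm`), applied to
an extension of `u - u_Ω`. The extension operator costs the full norm of `u - u_Ω`, whose `L^p` part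
the Poincaré inequality absorbs into the seminorm.

For the Sobolev inequality let `a_k = |{|u| > 2^k}|`. If `|u(x)| > 2^k` and `|u(y)| ≤ 2^{k-1}`, then
`|u(x) - u(y)| ≥ |u(x)|/2`. Among sets of given measure the complement of a superlevel set carries
the least `ν`-mass, so the energy dominates `∑ 2^{kp} a_k ν^#(a_{k-1})` up to a constant
(`tsum_nuSharp_dyadicLevel_le`). The quantity needed is instead `∑ (2^k w(a_k))^p = ∑ 2^{kp} a_k
ν^#(a_k)`. The growth condition (`exists_wFun_rpow_le`) replaces `ν^#(a_k)` by `ν^#(a_{k-1})` at the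
price of half the preceding term, which is absorbed. Finally `φ(1/w(a)) = 1/a` and convexity give
`φ(t) a ≤ (t w(a))^p` when `t w(a) ≤ 1`, so the sum bounds the modular. -/

lemma unitBallVolume_mul_ballRadius_pow (hd : 1 ≤ d) (r : ℝ≥0∞) :
    unitBallVolume d * ballRadius d r ^ d = r := by
  have h0 : unitBallVolume d ≠ 0 := (Metric.measure_ball_pos volume _ one_pos).ne'
  have h1 : unitBallVolume d ≠ ∞ := measure_ball_lt_top.ne
  have hd' : (d : ℝ) ≠ 0 := by positivity
  rw [ballRadius, ← ENNReal.rpow_natCast, ← ENNReal.rpow_mul, one_div, inv_mul_cancel₀ hd',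
    ENNReal.rpow_one, ENNReal.mul_div_cancel h0 h1]

/-- Bathtub principle: with `G = {ν > s}`, the hypothesis gives `|B \ G| ≤ |G \ B|`, while `ν ≤ s`
on the former and `ν > s` on the latter. Exchanging the two sets can only increase the mass. -/
lemma setLIntegral_le_of_measure_le (hν : Measurable ν) {B : Set (EuclideanSpace ℝ (Fin d))}
    (hB : MeasurableSet B) (hfin : volume B ≠ ∞) {s : ℝ≥0∞}
    (hs : volume B ≤ volume {h | s < ν h}) :
    ∫⁻ h in {h | ν h ≤ s}, ν h ≤ ∫⁻ h in Bᶜ, ν h := by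
  have hL : MeasurableSet {h | ν h ≤ s} := measurableSet_le hν measurable_const
  have hG : MeasurableSet {h | s < ν h} := measurableSet_lt measurable_const hν
  have hLG : {h | ν h ≤ s}ᶜ = {h | s < ν h} := by ext; simp
  have hmeas : volume (B ∩ {h | ν h ≤ s}) ≤ volume ({h | s < ν h} \ B) := by
    rw [← measure_inter_add_sdiff B hL, ← measure_inter_add_sdiff {h | s < ν h} hB, sdiff_eq, hLG,
      inter_comm _ B, add_comm (volume (B ∩ {h | s < ν h}))] at hs
    exact (ENNReal.add_le_add_iff_right (measure_ne_top_of_subset inter_subset_left hfin)).1 hs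
  calc ∫⁻ h in {h | ν h ≤ s}, ν h
      = (∫⁻ h in {h | ν h ≤ s} ∩ B, ν h) + ∫⁻ h in {h | ν h ≤ s} \ B, ν h :=
        (lintegral_inter_add_sdiff _ _ hB).symm
    _ ≤ s * volume (B ∩ {h | ν h ≤ s}) + ∫⁻ h in {h | ν h ≤ s} \ B, ν h := by
        gcongr
        rw [inter_comm, ← setLIntegral_const]
        exact setLIntegral_mono' (hB.inter hL) fun h hh => hh.2
    _ ≤ s * volume ({h | s < ν h} \ B) + ∫⁻ h in {h | ν h ≤ s} \ B, ν h := by gcongr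
    _ ≤ (∫⁻ h in {h | s < ν h} \ B, ν h) + ∫⁻ h in {h | ν h ≤ s} \ B, ν h := by
        gcongr
        rw [← setLIntegral_const]
        exact setLIntegral_mono' (hG.diff hB) fun h hh => le_of_lt hh.1
    _ = ∫⁻ h in Bᶜ, ν h := by
        rw [add_comm, ← lintegral_inter_add_sdiff (B := {h | ν h ≤ s}) ν Bᶜ hL, sdiff_eq, sdiff_eq,
          sdiff_eq, hLG, inter_comm, inter_comm Bᶜ {h | s < ν h}, inter_comm Bᶜ]

/-- Among the sets of given measure, the mass of `ν` outside is least for a superlevel set. -/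
lemma nuSharp_le_setLIntegral_compl (hd : 1 ≤ d) (hν : Measurable ν)
    {B : Set (EuclideanSpace ℝ (Fin d))} (hB : MeasurableSet B) (hfin : volume B ≠ ∞) :
    nuSharp ν (volume B) ≤ ∫⁻ h in Bᶜ, ν h := by
  unfold nuSharp
  set s := symmRearrangement ν (ballRadius d (volume B)) with hs
  rcases eq_or_ne s 0 with h0 | h0
  · simp [h0]
  -- Approximating from strictly below the infimum defining `ν^*` ensures `|{ν > t n}| > |B|`, which
  -- may fail at the infimum itself.
  obtain ⟨t, ht_mono, ht_mem, ht_lim⟩ :=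
    exists_seq_strictMono_tendsto' (pos_iff_ne_zero.2 h0)
  have hU : {h | ν h < s} = ⋃ n, {h | ν h ≤ t n} := by
    ext h
    simp only [mem_ofPred_eq, mem_iUnion]
    constructor
    · intro hh
      obtain ⟨n, hn⟩ := ((tendsto_order.1 ht_lim).1 _ hh).exists
      exact ⟨n, hn.le⟩
    · rintro ⟨n, hn⟩
      exact hn.trans_lt (ht_mem n).2
  rw [hU, setLIntegral_iUnion_of_directed]
  · refine iSup_le fun n => setLIntegral_le_of_measure_le hν hB hfin ?_
    by_contra! hlt
    refine (ht_mem n).2.not_ge (sInf_le ⟨(ht_mem n).1, ?_⟩)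
    rw [unitBallVolume_mul_ballRadius_pow hd]
    exact hlt.le
  · refine (monotone_nat_of_le_succ fun n h hh => ?_).directed_le
    exact le_trans (α := ℝ≥0∞) hh (ht_mono n.lt_succ_self).le

/-- The reflected translate `x - A` has the measure of `A`, so the bound is uniform in `x`. -/
lemma nuSharp_le_setLIntegral_sub (hd : 1 ≤ d) (hν : Measurable ν)
    {A : Set (EuclideanSpace ℝ (Fin d))} (hA : MeasurableSet A) (hfin : volume A ≠ ∞)
    (x : EuclideanSpace ℝ (Fin d)) :
    nuSharp ν (volume A) ≤ ∫⁻ y in Aᶜ, ν (x - y) := by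
  have hmp : MeasurePreserving (fun y : EuclideanSpace ℝ (Fin d) => x - y) volume volume :=
    Measure.measurePreserving_sub_left volume x
  have hB : MeasurableSet ((fun y => x - y) ⁻¹' A) := hmp.measurable hA
  have hvol : volume ((fun y => x - y) ⁻¹' A) = volume A :=
    hmp.measure_preimage hA.nullMeasurableSet
  have h := nuSharp_le_setLIntegral_compl hd hν hB (hvol ▸ hfin)
  rw [hvol, ← hmp.setLIntegral_comp_preimage hB.compl hν] at h
  simpa [← preimage_compl, ← preimage_comp, Function.comp_def] using h

lemma nuSharp_antitone : Antitone (nuSharp ν) := by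
  intro r r' h
  refine lintegral_mono_set fun x (hx : ν x < _) => hx.trans_le (sInf_le_sInf ?_)
  rintro s ⟨hs, hs'⟩
  refine ⟨hs, hs'.trans ?_⟩
  unfold ballRadius
  gcongr

lemma wFun_rpow (hp : 1 ≤ p) {r : ℝ≥0∞} (hr : r ≠ ∞) : wFun ν p r ^ p = r * nuSharp ν r := by
  rw [wFun, if_neg hr, ← ENNReal.rpow_mul, one_div, inv_mul_cancel₀ (by positivity),
    ENNReal.rpow_one]

lemma wFun_zero (hp : 1 ≤ p) : wFun ν p 0 = 0 := by
  simp [wFun, show 0 < p by positivity]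

lemma wFun_top : wFun ν p ∞ = ∞ := by simp [wFun]

namespace IsAdmissibleKernel

lemma criticalFun_inv_wFun (hν : IsAdmissibleKernel ν p) (r : ℝ≥0∞) :
    criticalFun ν p (wFun ν p r)⁻¹ = r⁻¹ := by
  rw [criticalFun, inv_inv, Function.leftInverse_invFun hν.bijective.1]

lemma criticalFun_injective (hν : IsAdmissibleKernel ν p) :
    Function.Injective (criticalFun ν p) := by
  intro s t h
  simp only [criticalFun, inv_inj] at h
  have h' := congrArg (wFun ν p) h
  rwa [Function.rightInverse_invFun hν.bijective.2, Function.rightInverse_invFun hν.bijective.2,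
    inv_inj] at h'

lemma criticalFun_zero (hν : IsAdmissibleKernel ν p) : criticalFun ν p 0 = 0 := by
  simpa [wFun_top] using hν.criticalFun_inv_wFun ∞

lemma criticalFun_top (hν : IsAdmissibleKernel ν p) (hp : 1 ≤ p) : criticalFun ν p ∞ = ∞ := by
  simpa [wFun_zero hp] using hν.criticalFun_inv_wFun 0

lemma criticalFun_ne_zero (hν : IsAdmissibleKernel ν p) {t : ℝ≥0∞} (ht : t ≠ 0) :
    criticalFun ν p t ≠ 0 := by
  rw [← hν.criticalFun_zero]; exact hν.criticalFun_injective.ne ht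

lemma criticalFun_ne_top (hν : IsAdmissibleKernel ν p) (hp : 1 ≤ p) {t : ℝ≥0∞} (ht : t ≠ ∞) :
    criticalFun ν p t ≠ ∞ := by
  rw [← hν.criticalFun_top hp]; exact hν.criticalFun_injective.ne ht

/-- `φ(s) ≤ (s/t)^p φ(t)` for `s ≤ t`, from the convexity of `t ↦ φ(t^{1/p})`. -/
lemma criticalFun_le_rpow_mul (hν : IsAdmissibleKernel ν p) (hp : 1 ≤ p) {s t : ℝ≥0∞}
    (hst : s ≤ t) (ht : t ≠ ∞) :
    criticalFun ν p s ≤ (s / t) ^ p * criticalFun ν p t := by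
  have hp0 : 0 < p := by positivity
  rcases eq_or_ne t 0 with rfl | ht0
  · simp [nonpos_iff_eq_zero.1 hst, hν.criticalFun_zero]
  have hle : (s / t) ^ p ≤ 1 := ENNReal.rpow_le_one (ENNReal.div_le_of_le_mul (by simpa)) hp0.le
  lift (s / t) ^ p to ℝ≥0 using (hle.trans_lt ENNReal.one_lt_top).ne with c hc
  have hc1 : c ≤ 1 := by exact_mod_cast hle
  -- Convexity on the segment from `0` to `t^p`, at the point `s^p = c t^p`.
  have h := hν.young.convexOn.2 (mem_univ (t ^ p)) (mem_univ 0) (zero_le (a := c))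
    (zero_le (a := 1 - c)) (add_tsub_cancel_of_le hc1)
  have h1 : c • t ^ p + (1 - c) • (0 : ℝ≥0∞) = s ^ p := by
    rw [smul_zero, add_zero, ENNReal.smul_def, smul_eq_mul, hc,
      ← ENNReal.mul_rpow_of_nonneg _ _ hp0.le, ENNReal.div_mul_cancel ht0 ht]
  have h2 (x : ℝ≥0∞) : (x ^ p) ^ (1 / p) = x := by
    rw [← ENNReal.rpow_mul, mul_one_div_cancel hp0.ne', ENNReal.rpow_one]
  simp only [h1, h2] at h
  rw [ENNReal.zero_rpow_of_pos (by positivity : 0 < 1 / p), hν.criticalFun_zero, smul_zero,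
    add_zero, ENNReal.smul_def, smul_eq_mul] at h
  exact h

lemma criticalFun_mono (hν : IsAdmissibleKernel ν p) (hp : 1 ≤ p) :
    Monotone (criticalFun ν p) := by
  intro s t hst
  rcases eq_or_ne t ∞ with rfl | ht
  · simp [hν.criticalFun_top hp]
  refine (hν.criticalFun_le_rpow_mul hp hst ht).trans (mul_le_of_le_one_left' ?_)
  exact ENNReal.rpow_le_one (ENNReal.div_le_of_le_mul (by simpa)) (by positivity)

/-- Not visible from `r ν^#(r)`, a product of an increasing and a decreasing factor; it is read off
from the monotonicity of `φ` through `φ(1/w(r)) = 1/r`. -/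
lemma wFun_mono (hν : IsAdmissibleKernel ν p) (hp : 1 ≤ p) : Monotone (wFun ν p) := by
  intro r r' h
  by_contra! hlt
  have h1 := hν.criticalFun_mono hp (ENNReal.inv_le_inv.2 hlt.le)
  rw [hν.criticalFun_inv_wFun, hν.criticalFun_inv_wFun, ENNReal.inv_le_inv] at h1
  exact hlt.ne' (congrArg _ (h.antisymm h1))

lemma wFun_ne_zero (hν : IsAdmissibleKernel ν p) (hp : 1 ≤ p) {r : ℝ≥0∞} (hr : r ≠ 0) :
    wFun ν p r ≠ 0 := by
  rw [← wFun_zero (ν := ν) hp]; exact hν.bijective.1.ne hr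

lemma wFun_ne_top (hν : IsAdmissibleKernel ν p) {r : ℝ≥0∞} (hr : r ≠ ∞) :
    wFun ν p r ≠ ∞ := by
  rw [← wFun_top (ν := ν) (p := p)]; exact hν.bijective.1.ne hr

lemma nuSharp_ne_top (hν : IsAdmissibleKernel ν p) (hp : 1 ≤ p) {r : ℝ≥0∞} (hr0 : r ≠ 0)
    (hr : r ≠ ∞) : nuSharp ν r ≠ ∞ := by
  intro h
  have h1 := wFun_rpow (ν := ν) hp hr
  rw [h, ENNReal.mul_top hr0] at h1
  exact ENNReal.rpow_ne_top_of_nonneg (by positivity) (hν.wFun_ne_top hr) h1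

/-- A form of the growth condition for `w` instead of `φ`. -/
lemma exists_wFun_rpow_le (hν : IsAdmissibleKernel ν p) (hp : 1 ≤ p) :
    ∃ M : ℝ≥0, ∀ a b : ℝ≥0∞, a ≤ b → b ≠ ∞ →
      wFun ν p a ^ p ≤ 2⁻¹ * (2⁻¹ * wFun ν p b) ^ p + M * (a * nuSharp ν b) := by
  obtain ⟨θ, hθ, hgrowth⟩ := hν.growth
  have hp0 : 0 < p := by positivity
  -- Chosen so that `τ^p = 2⁻¹ · 2^{-p}`: if `w(a) ≤ τ w(b)`, the first term on the right suffices.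
  set τ : ℝ≥0∞ := 2⁻¹ ^ (1 / p) * 2⁻¹ with hτ
  have hτ0 : τ ≠ 0 := by
    refine mul_ne_zero ?_ (by simp)
    exact (ENNReal.rpow_pos (by simp) (by simp)).ne'
  have hτp : τ ^ p = 2⁻¹ * 2⁻¹ ^ p := by
    rw [hτ, ENNReal.mul_rpow_of_nonneg _ _ hp0.le, ← ENNReal.rpow_mul, one_div,
      inv_mul_cancel₀ hp0.ne', ENNReal.rpow_one]
  have hφ0 : criticalFun ν p (θ * τ) ≠ 0 :=
    hν.criticalFun_ne_zero (mul_ne_zero (by exact_mod_cast hθ.ne') hτ0)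
  have hφ1 : criticalFun ν p (θ * τ) ≠ ∞ := by
    refine hν.criticalFun_ne_top hp (ENNReal.mul_ne_top ENNReal.coe_ne_top ?_)
    exact ENNReal.mul_ne_top (ENNReal.rpow_ne_top_of_nonneg (by positivity) (by simp)) (by simp)
  refine ⟨(criticalFun ν p (θ * τ))⁻¹.toNNReal, fun a b hab hb => ?_⟩
  rw [ENNReal.coe_toNNReal (ENNReal.inv_ne_top.2 hφ0)]
  have ha : a ≠ ∞ := ne_top_of_le_ne_top hb hab
  rcases eq_or_ne a 0 with rfl | ha0
  · simp [wFun_zero hp, ENNReal.zero_rpow_of_pos hp0]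
  have hb0 : b ≠ 0 := fun h => ha0 (by simpa [h] using hab)
  have hwa0 := hν.wFun_ne_zero hp ha0
  have hwb0 := hν.wFun_ne_zero hp hb0
  have hwa := hν.wFun_ne_top ha
  have hwb := hν.wFun_ne_top hb
  have hw := hν.wFun_mono hp hab
  rcases le_total (wFun ν p a) (τ * wFun ν p b) with hle | hle
  · refine le_add_right ?_
    rw [ENNReal.mul_rpow_of_nonneg _ _ hp0.le, ← mul_assoc, ← hτp,
      ← ENNReal.mul_rpow_of_nonneg _ _ hp0.le]
    exact ENNReal.rpow_le_rpow hle hp0.le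
  · refine le_add_left ?_
    -- Otherwise `w(a)/w(b) ≥ τ`, and the growth condition gives `φ(θτ) ≤ a/b`: the measures are
    -- comparable, and `w(b)^p = b ν^#(b)` costs only the factor `1/φ(θτ)`.
    have h1 := hgrowth (wFun ν p b)⁻¹ (wFun ν p a)⁻¹ (by simp [hwa])
      (by simpa using hwa0) (ENNReal.inv_le_inv.2 hw)
    rw [hν.criticalFun_inv_wFun, hν.criticalFun_inv_wFun] at h1
    have h2 : criticalFun ν p (θ * τ) ≤ a / b := by
      refine (hν.criticalFun_mono hp ?_).trans (h1.trans_eq ?_)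
      · gcongr
        rw [div_eq_mul_inv, inv_inv, mul_comm, ← div_eq_mul_inv]
        exact (ENNReal.le_div_iff_mul_le (Or.inl hwb0) (Or.inl hwb)).2 hle
      · rw [div_eq_mul_inv, inv_inv, mul_comm, div_eq_mul_inv]
    calc wFun ν p a ^ p ≤ wFun ν p b ^ p := ENNReal.rpow_le_rpow hw hp0.le
      _ = (criticalFun ν p (θ * τ))⁻¹ * criticalFun ν p (θ * τ) * wFun ν p b ^ p := by
          rw [ENNReal.inv_mul_cancel hφ0 hφ1, one_mul]
      _ ≤ (criticalFun ν p (θ * τ))⁻¹ * (a / b) * (b * nuSharp ν b) := by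
          rw [wFun_rpow hp hb]; gcongr
      _ = (criticalFun ν p (θ * τ))⁻¹ * (a * nuSharp ν b) := by
          rw [mul_assoc, ← mul_assoc (a / b), ENNReal.div_mul_cancel hb0 hb]

end IsAdmissibleKernel

end Kernel

/-! ### Dyadic sums and absorption -/

section Sums

lemma two_zpow_ne_zero (k : ℤ) : (2 : ℝ≥0∞) ^ k ≠ 0 := (ENNReal.zpow_pos (by simp) (by simp) k).ne'

lemma two_zpow_ne_top (k : ℤ) : (2 : ℝ≥0∞) ^ k ≠ ∞ := ENNReal.zpow_ne_top (by simp) (by simp) k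

lemma two_zpow_add_one (k : ℤ) : (2 : ℝ≥0∞) ^ (k + 1) = 2 * 2 ^ k := by
  rw [ENNReal.zpow_add (by simp) (by simp), zpow_one, mul_comm]

lemma two_mul_two_zpow_sub_one (k : ℤ) : 2 * (2 : ℝ≥0∞) ^ (k - 1) = 2 ^ k := by
  rw [← two_zpow_add_one, sub_add_cancel]

/-- The powers `2^{kp}` with `2^k < b` add up to at most `2 b^p`. -/
lemma tsum_two_zpow_rpow_le {p : ℝ} (hp : 1 ≤ p) (b : ℝ≥0∞) (hb : b ≠ ∞) :
    ∑' k : ℤ, (if (2 : ℝ≥0∞) ^ k < b then ((2 : ℝ≥0∞) ^ k) ^ p else 0) ≤ 2 * b ^ p := by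
  rcases eq_or_ne b 0 with rfl | hb0
  · simp
  obtain ⟨K, hK1, hK2⟩ := ENNReal.exists_mem_Ioc_zpow hb0 hb ENNReal.one_lt_two (by simp)
  have hinj : Function.Injective (fun j : ℕ => K - (j : ℤ)) := fun i j h => by simpa using h
  rw [← hinj.tsum_eq]
  · calc _ ≤ ∑' j : ℕ, b ^ p * 2⁻¹ ^ j := by
          refine ENNReal.tsum_le_tsum fun j => ?_
          split_ifs
          · have hj : (2 : ℝ≥0∞) ^ (K - (j : ℤ)) = 2 ^ K * 2⁻¹ ^ j := by
              rw [sub_eq_add_neg, ENNReal.zpow_add (by simp) (by simp), ENNReal.zpow_neg,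
                zpow_natCast, ENNReal.inv_pow]
            rw [hj, ENNReal.mul_rpow_of_nonneg _ _ (by positivity)]
            gcongr
            exact ENNReal.rpow_le_self_of_le_one (pow_le_one₀ (by simp) (by simp)) hp
          · simp
      _ = 2 * b ^ p := by
          rw [ENNReal.tsum_mul_left, ENNReal.tsum_geometric, ENNReal.one_sub_inv_two, inv_inv,
            mul_comm]
  · intro k hk
    have hlt : (2 : ℝ≥0∞) ^ k < b := by
      by_contra h
      simp [h] at hk
    have hkK : k < K + 1 := by
      by_contra! h
      exact absurd (hlt.trans_le hK2) (ENNReal.zpow_le_of_le (by norm_num) h).not_gt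
    exact ⟨(K - k).toNat, by simp only; omega⟩

/-- If `x_k ≤ x_{k-1} / 2 + e_k` on `ℤ`, where the terms `x_{k-n}` are bounded if `x_k ≠ 0`,
then `∑ x_k ≤ 2 ∑ e_k`. -/
lemma tsum_le_of_le_half_add {x e : ℤ → ℝ≥0∞} (h : ∀ k, x k ≤ 2⁻¹ * x (k - 1) + e k)
    (hbdd : ∀ k, x k ≠ 0 → ∃ B : ℝ≥0∞, B ≠ ∞ ∧ ∀ n : ℕ, x (k - n) ≤ B) :
    ∑' k, x k ≤ 2 * ∑' k, e k := by
  -- Subtracting half the sum would require it to be finite. The recursion is iterated instead, and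
  -- boundedness makes the remainder `2^{-n} x_{k-n}` vanish.
  have hit (k : ℤ) (n : ℕ) :
      x k ≤ 2⁻¹ ^ n * x (k - n) + ∑ j ∈ Finset.range n, 2⁻¹ ^ j * e (k - j) := by
    induction n with
    | zero => simp
    | succ n ih =>
      refine ih.trans ?_
      rw [Finset.sum_range_succ, add_comm (Finset.sum _ _), ← add_assoc]
      gcongr
      calc 2⁻¹ ^ n * x (k - n) ≤ 2⁻¹ ^ n * (2⁻¹ * x (k - n - 1) + e (k - n)) := by
            gcongr; exact h _
        _ = 2⁻¹ ^ (n + 1) * x (k - (n + 1 : ℕ)) + 2⁻¹ ^ n * e (k - n) := by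
            rw [mul_add, ← mul_assoc, ← pow_succ, Nat.cast_succ, sub_sub]
  have hx (k : ℤ) : x k ≤ ∑' j : ℕ, 2⁻¹ ^ j * e (k - j) := by
    rcases eq_or_ne (x k) 0 with h0 | h0
    · simp [h0]
    obtain ⟨B, hB, hxB⟩ := hbdd k h0
    have hlim : Filter.Tendsto (fun n : ℕ => (2⁻¹ : ℝ≥0∞) ^ n * B + ∑' j : ℕ, 2⁻¹ ^ j * e (k - j))
        Filter.atTop (nhds (0 * B + ∑' j : ℕ, 2⁻¹ ^ j * e (k - j))) :=
      (ENNReal.Tendsto.mul_const (ENNReal.tendsto_pow_atTop_nhds_zero_of_lt_one (by simp))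
        (Or.inr hB)).add tendsto_const_nhds
    rw [zero_mul, zero_add] at hlim
    refine ge_of_tendsto' hlim fun n => (hit k n).trans ?_
    gcongr
    · exact hxB n
    · exact ENNReal.sum_le_tsum _
  calc ∑' k, x k ≤ ∑' (k : ℤ) (j : ℕ), 2⁻¹ ^ j * e (k - j) := ENNReal.tsum_le_tsum hx
    _ = ∑' (j : ℕ), 2⁻¹ ^ j * ∑' k : ℤ, e (k - j) := by
        rw [ENNReal.tsum_comm]
        simp_rw [ENNReal.tsum_mul_left]
    _ = ∑' (j : ℕ), 2⁻¹ ^ j * ∑' k : ℤ, e k := by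
        congr with j
        exact congrArg _ ((Equiv.subRight (j : ℤ)).tsum_eq e)
    _ = 2 * ∑' k, e k := by
        rw [ENNReal.tsum_mul_right, ENNReal.tsum_geometric, ENNReal.one_sub_inv_two, inv_inv]

end Sums

/-! ### Dyadic level sets and the energy -/

section LevelSets

variable {d : ℕ} {ν : EuclideanSpace ℝ (Fin d) → ℝ≥0∞} {p : ℝ}
  {u : EuclideanSpace ℝ (Fin d) → ℝ}

/-- The dyadic superlevel set `{|u| > 2^k}`. -/
def dyadicLevel (u : EuclideanSpace ℝ (Fin d) → ℝ) (k : ℤ) : Set (EuclideanSpace ℝ (Fin d)) :=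
  {x | (2 : ℝ≥0∞) ^ k < ‖u x‖ₑ}

lemma measurableSet_dyadicLevel (hu : Measurable u) (k : ℤ) :
    MeasurableSet (dyadicLevel u k) := measurableSet_lt measurable_const hu.enorm

lemma dyadicLevel_antitone : Antitone (dyadicLevel u) := fun _ _ h x hx =>
  (ENNReal.zpow_le_of_le (x := 2) (by norm_num) h).trans_lt (show _ < _ from hx)

lemma rpow_mul_volume_dyadicLevel_le (hp : 1 ≤ p) (hu : Measurable u) (k : ℤ) :
    ((2 : ℝ≥0∞) ^ k) ^ p * volume (dyadicLevel u k) ≤ ∫⁻ x, ‖u x‖ₑ ^ p := by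
  rw [← setLIntegral_const]
  refine le_trans ?_ (setLIntegral_le_lintegral (dyadicLevel u k) _)
  exact setLIntegral_mono' (measurableSet_dyadicLevel hu k) fun x hx =>
    ENNReal.rpow_le_rpow (le_of_lt hx) (by positivity)

lemma volume_dyadicLevel_ne_top (hp : 1 ≤ p) (hu : Measurable u) (hLp : ∫⁻ x, ‖u x‖ₑ ^ p ≠ ∞) (k : ℤ) :
    volume (dyadicLevel u k) ≠ ∞ := by
  intro h
  refine hLp (top_unique ?_)
  refine le_trans ?_ (rpow_mul_volume_dyadicLevel_le hp hu k)
  rw [h, ENNReal.mul_top]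
  exact (ENNReal.rpow_pos (two_zpow_ne_zero k).bot_lt (two_zpow_ne_top k)).ne'

/-- A single nonzero term already forces `|u(x)| ≤ 2 |u(x) - u(y)|`; the whole sum is then at most
the geometric sum over `2^k < |u(x)|`, that is `2 |u(x)|^p`. -/
lemma tsum_dyadicLevel_le_enorm_sub (hp : 1 ≤ p) (x y : EuclideanSpace ℝ (Fin d)) :
    ∑' k : ℤ, (dyadicLevel u k).indicator 1 x * (dyadicLevel u (k - 1))ᶜ.indicator 1 y *
      ((2 : ℝ≥0∞) ^ k) ^ p ≤ 2 * 2 ^ p * ‖u x - u y‖ₑ ^ p := by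
  have hp0 : 0 ≤ p := by positivity
  have key (k : ℤ) (hx : x ∈ dyadicLevel u k) (hy : y ∉ dyadicLevel u (k - 1)) :
      ‖u x‖ₑ ≤ 2 * ‖u x - u y‖ₑ := by
    have hx' : (2 : ℝ≥0∞) ^ k < ‖u x‖ₑ := hx
    have hy' : ‖u y‖ₑ ≤ (2 : ℝ≥0∞) ^ (k - 1) := not_lt.1 hy
    have h1 : ‖u x‖ₑ ≤ ‖u x - u y‖ₑ + ‖u y‖ₑ := by
      simpa using enorm_add_le (u x - u y) (u y)
    have h2 : 2 * ‖u y‖ₑ ≤ ‖u x‖ₑ := by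
      refine le_trans ?_ hx'.le
      rw [← two_mul_two_zpow_sub_one]
      gcongr
    have h3 : ‖u x‖ₑ + ‖u x‖ₑ ≤ 2 * ‖u x - u y‖ₑ + ‖u x‖ₑ :=
      calc ‖u x‖ₑ + ‖u x‖ₑ = 2 * ‖u x‖ₑ := (two_mul _).symm
        _ ≤ 2 * (‖u x - u y‖ₑ + ‖u y‖ₑ) := by gcongr
        _ = 2 * ‖u x - u y‖ₑ + 2 * ‖u y‖ₑ := mul_add _ _ _
        _ ≤ _ := by gcongr
    exact (ENNReal.add_le_add_iff_right enorm_ne_top).1 h3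
  by_cases hex : ∃ k, x ∈ dyadicLevel u k ∧ y ∉ dyadicLevel u (k - 1)
  · obtain ⟨k, hx, hy⟩ := hex
    calc _ ≤ ∑' k : ℤ, (if (2 : ℝ≥0∞) ^ k < ‖u x‖ₑ then ((2 : ℝ≥0∞) ^ k) ^ p else 0) := by
          refine ENNReal.tsum_le_tsum fun k => ?_
          by_cases hx : x ∈ dyadicLevel u k
          · rw [if_pos (show (2 : ℝ≥0∞) ^ k < ‖u x‖ₑ from hx), indicator_of_mem hx, Pi.one_apply,
              one_mul]
            exact mul_le_of_le_one_left' (indicator_le_self' (by simp) y)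
          · simp [hx]
      _ ≤ 2 * ‖u x‖ₑ ^ p := tsum_two_zpow_rpow_le hp _ enorm_ne_top
      _ ≤ 2 * (2 * ‖u x - u y‖ₑ) ^ p := by gcongr; exact key k hx hy
      _ = _ := by rw [ENNReal.mul_rpow_of_nonneg _ _ hp0, mul_assoc]
  · push Not at hex
    refine (ENNReal.tsum_eq_zero.2 fun k => ?_).trans_le zero_le
    by_cases hx : x ∈ dyadicLevel u k
    · simp [hex k hx]
    · simp [hx]

/-- The energy controls the dyadic level sets. -/
lemma tsum_nuSharp_dyadicLevel_le (hd : 1 ≤ d) (hν : Measurable ν) (hp : 1 ≤ p)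
    (hu : Measurable u) (hfin : ∀ k, volume (dyadicLevel u k) ≠ ∞) :
    ∑' k : ℤ, ((2 : ℝ≥0∞) ^ k) ^ p *
      (volume (dyadicLevel u k) * nuSharp ν (volume (dyadicLevel u (k - 1)))) ≤
      2 * 2 ^ p * nlEnergy ν p univ u := by
  have hA := measurableSet_dyadicLevel hu
  have hC : (2 * 2 ^ p : ℝ≥0∞) ≠ ∞ :=
    ENNReal.mul_ne_top (by simp) (ENNReal.rpow_ne_top_of_nonneg (by positivity) (by simp))
  calc _ = ∑' k : ℤ, ∫⁻ x, (dyadicLevel u k).indicator 1 x *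
        (((2 : ℝ≥0∞) ^ k) ^ p * nuSharp ν (volume (dyadicLevel u (k - 1)))) := by
        congr with k
        rw [lintegral_mul_const _ (measurable_one.indicator (hA k)), lintegral_indicator_one (hA k)]
        ring
    _ = ∫⁻ x, ∑' k : ℤ, (dyadicLevel u k).indicator 1 x *
        (((2 : ℝ≥0∞) ^ k) ^ p * nuSharp ν (volume (dyadicLevel u (k - 1)))) := by
        refine (lintegral_tsum fun k => ?_).symm
        exact ((measurable_one.indicator (hA k)).mul_const _).aemeasurable
    _ ≤ ∫⁻ x, ∫⁻ y, ∑' k : ℤ, ((dyadicLevel u k).indicator 1 x *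
        (dyadicLevel u (k - 1))ᶜ.indicator 1 y * ((2 : ℝ≥0∞) ^ k) ^ p) * ν (x - y) := by
        refine lintegral_mono fun x => ?_
        have hm (k : ℤ) : Measurable fun y =>
            (dyadicLevel u (k - 1))ᶜ.indicator (1 : EuclideanSpace ℝ (Fin d) → ℝ≥0∞) y * ν (x - y) :=
          (measurable_one.indicator (hA _).compl).mul
            (hν.comp (measurable_const.sub measurable_id))
        have hform (k : ℤ) (y : EuclideanSpace ℝ (Fin d)) :
            ((dyadicLevel u k).indicator (1 : EuclideanSpace ℝ (Fin d) → ℝ≥0∞) x *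
              (dyadicLevel u (k - 1))ᶜ.indicator 1 y * ((2 : ℝ≥0∞) ^ k) ^ p) * ν (x - y) =
            ((dyadicLevel u k).indicator 1 x * ((2 : ℝ≥0∞) ^ k) ^ p) *
              ((dyadicLevel u (k - 1))ᶜ.indicator 1 y * ν (x - y)) := by ring
        simp_rw [hform]
        rw [lintegral_tsum fun k => ((hm k).const_mul _).aemeasurable]
        refine ENNReal.tsum_le_tsum fun k => ?_
        rw [lintegral_const_mul _ (hm k), ← mul_assoc]
        gcongr
        refine (nuSharp_le_setLIntegral_sub hd hν (hA (k - 1)) (hfin _) x).trans_eq ?_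
        rw [← lintegral_indicator (hA _).compl]
        refine lintegral_congr fun y => ?_
        by_cases hy : y ∈ (dyadicLevel u (k - 1))ᶜ
        · rw [indicator_of_mem hy, indicator_of_mem hy, Pi.one_apply, one_mul]
        · rw [indicator_of_notMem hy, indicator_of_notMem hy, zero_mul]
    _ ≤ ∫⁻ x, ∫⁻ y, 2 * 2 ^ p * (‖u x - u y‖ₑ ^ p * ν (x - y)) := by
        refine lintegral_mono fun x => lintegral_mono fun y => ?_
        rw [ENNReal.tsum_mul_right, ← mul_assoc]
        gcongr
        exact tsum_dyadicLevel_le_enorm_sub hp x y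
    _ = 2 * 2 ^ p * nlEnergy ν p univ u := by
        simp_rw [nlEnergy, Measure.restrict_univ, lintegral_const_mul' _ _ hC]

lemma exists_tsum_wFun_dyadicLevel_le (hd : 1 ≤ d) (hp : 1 ≤ p) (hν : IsAdmissibleKernel ν p) :
    ∃ K : ℝ≥0, ∀ u : EuclideanSpace ℝ (Fin d) → ℝ, Measurable u → ∫⁻ x, ‖u x‖ₑ ^ p ≠ ∞ →
      ∑' k : ℤ, (2 ^ k * wFun ν p (volume (dyadicLevel u k))) ^ p ≤ K * nlEnergy ν p univ u := by
  have hp0 : 0 ≤ p := by positivity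
  obtain ⟨M, hM⟩ := hν.exists_wFun_rpow_le hp
  refine ⟨2 * (M * (2 * 2 ^ p)), fun u hu hLp => ?_⟩
  have hfin := volume_dyadicLevel_ne_top hp hu hLp
  have hsum := tsum_le_of_le_half_add
    (x := fun k : ℤ => (2 ^ k * wFun ν p (volume (dyadicLevel u k))) ^ p)
    (e := fun k : ℤ => M * (((2 : ℝ≥0∞) ^ k) ^ p *
      (volume (dyadicLevel u k) * nuSharp ν (volume (dyadicLevel u (k - 1))))))
    (fun k => ?_) (fun k hk => ?_)
  · refine hsum.trans ?_
    rw [ENNReal.tsum_mul_left]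
    have h := tsum_nuSharp_dyadicLevel_le hd hν.measurable hp hu hfin
    calc _ ≤ 2 * (M * (2 * 2 ^ p * nlEnergy ν p univ u)) := by gcongr
      _ = _ := by
        push_cast
        rw [ENNReal.coe_rpow_of_nonneg _ hp0]
        push_cast
        ring
  · have h := hM _ _ (measure_mono (dyadicLevel_antitone (sub_one_lt k).le)) (hfin (k - 1))
    rw [ENNReal.mul_rpow_of_nonneg _ _ hp0]
    refine (mul_le_mul' (le_refl (((2 : ℝ≥0∞) ^ k) ^ p)) h).trans_eq ?_
    -- The shift from `2^k` to `2^{k-1}` uses up the inner `2⁻¹` of the growth estimate; the outer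
    -- one is the contraction factor.
    have h2 : (2 : ℝ≥0∞) ^ (k - 1) = 2 ^ k * 2⁻¹ := by
      rw [← two_mul_two_zpow_sub_one k, mul_right_comm, ENNReal.mul_inv_cancel (by simp) (by simp),
        one_mul]
    rw [h2, mul_assoc ((2 : ℝ≥0∞) ^ k), ENNReal.mul_rpow_of_nonneg (2 ^ k) _ hp0]
    ring
  · have h0 : volume (dyadicLevel u k) ≠ 0 := by
      intro h0
      simp [h0, wFun_zero hp, show 0 < p by positivity] at hk
    -- Chebyshev bounds `2^{jp} a_j` by the `L^p` integral, and `ν^#(a_j) ≤ ν^#(a_k)` for `j ≤ k`;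
    -- the latter is finite because `a_k > 0`.
    refine ⟨(∫⁻ x, ‖u x‖ₑ ^ p) * nuSharp ν (volume (dyadicLevel u k)),
      ENNReal.mul_ne_top hLp (hν.nuSharp_ne_top hp h0 (hfin k)), fun n => ?_⟩
    rw [ENNReal.mul_rpow_of_nonneg _ _ hp0, wFun_rpow hp (hfin _), ← mul_assoc]
    gcongr
    · exact rpow_mul_volume_dyadicLevel_le hp hu _
    · exact nuSharp_antitone (measure_mono (dyadicLevel_antitone (by omega)))

end LevelSets

/-! ### Sobolev inequality, comparison of norms, and the two implications -/

section Inequalities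

variable {d : ℕ} {ν : EuclideanSpace ℝ (Fin d) → ℝ≥0∞} {p : ℝ}

/-- Where `u(x) ≠ 0`, some `k` has `2^k < |u(x)| ≤ 2^{k+1}`, and that term alone dominates because
`φ` is monotone. -/
lemma lintegral_criticalFun_le_tsum (hν : IsAdmissibleKernel ν p) (hp : 1 ≤ p)
    {u : EuclideanSpace ℝ (Fin d) → ℝ} (hu : Measurable u) (l : ℝ≥0∞) :
    ∫⁻ x, criticalFun ν p (‖u x‖ₑ / l) ≤
      ∑' k : ℤ, criticalFun ν p (2 * 2 ^ k / l) * volume (dyadicLevel u k) := by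
  have hA := measurableSet_dyadicLevel hu
  calc _ ≤ ∫⁻ x, ∑' k : ℤ,
        (dyadicLevel u k).indicator (fun _ => criticalFun ν p (2 * 2 ^ k / l)) x := by
        refine lintegral_mono fun x => ?_
        rcases eq_or_ne ‖u x‖ₑ 0 with h0 | h0
        · simp [h0, hν.criticalFun_zero]
        obtain ⟨k, hk1, hk2⟩ :=
          ENNReal.exists_mem_Ioc_zpow h0 enorm_ne_top ENNReal.one_lt_two (by simp)
        refine le_trans ?_ (ENNReal.le_tsum k)
        rw [indicator_of_mem (show x ∈ dyadicLevel u k from hk1), ← two_zpow_add_one]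
        exact hν.criticalFun_mono hp (by gcongr)
    _ = _ := by
        rw [lintegral_tsum fun k => (measurable_const.indicator (hA k)).aemeasurable]
        congr with k
        rw [lintegral_indicator_const (hA k)]

/-- If `t w(a) ≤ 1`, then `φ(t) a ≤ (t w(a))^p`. -/
lemma IsAdmissibleKernel.criticalFun_mul_le (hν : IsAdmissibleKernel ν p) (hp : 1 ≤ p)
    {t a : ℝ≥0∞} (ha : a ≠ ∞) (h : t * wFun ν p a ≤ 1) :
    criticalFun ν p t * a ≤ (t * wFun ν p a) ^ p := by
  rcases eq_or_ne a 0 with rfl | ha0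
  · simp
  have hw0 := hν.wFun_ne_zero hp ha0
  have hw := hν.wFun_ne_top ha
  have h1 := hν.criticalFun_le_rpow_mul hp (s := t) (t := (wFun ν p a)⁻¹)
    (by rw [← one_div]; exact (ENNReal.le_div_iff_mul_le (Or.inl hw0) (Or.inl hw)).2 h)
    (by simpa using hw0)
  rw [hν.criticalFun_inv_wFun, div_eq_mul_inv, inv_inv] at h1
  calc _ ≤ (t * wFun ν p a) ^ p * a⁻¹ * a := by gcongr
    _ = _ := by rw [mul_assoc, ENNReal.inv_mul_cancel ha0 ha, mul_one]

/-- The Sobolev inequality on `ℝ^d`. -/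
theorem exists_luxNorm_le_nlSeminorm (hd : 1 ≤ d) (hp : 1 ≤ p) (hν : IsAdmissibleKernel ν p) :
    ∃ K : ℝ≥0, ∀ u : EuclideanSpace ℝ (Fin d) → ℝ, Measurable u → ∫⁻ x, ‖u x‖ₑ ^ p ≠ ∞ →
      luxNorm (criticalFun ν p) univ u ≤ K * nlSeminorm ν p univ u := by
  have hp0 : 0 < p := by positivity
  obtain ⟨K, hK⟩ := exists_tsum_wFun_dyadicLevel_le hd hp hν
  refine ⟨2 * K ^ (1 / p), fun u hu hLp => ?_⟩
  have hfin := volume_dyadicLevel_ne_top hp hu hLp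
  -- Only `l` strictly above the bound are tested: the bound itself may be `0`, which is not an
  -- admissible `l`.
  refine le_of_forall_gt_imp_ge_of_dense fun l hl => ?_
  rcases eq_or_ne l ∞ with rfl | hltop
  · exact le_top
  lift l to ℝ≥0 using hltop
  have hl0 : (l : ℝ≥0∞) ≠ 0 := (zero_le.trans_lt hl).ne'
  refine iInf₂_le l ⟨pos_iff_ne_zero.2 (by exact_mod_cast hl0), ?_⟩
  rw [Measure.restrict_univ]
  have hsum : ∑' k : ℤ, (2 * 2 ^ k / l * wFun ν p (volume (dyadicLevel u k))) ^ p ≤ 1 := by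
    have h1 (k : ℤ) : (2 * 2 ^ k / l * wFun ν p (volume (dyadicLevel u k))) ^ p =
        (2 / l) ^ p * (2 ^ k * wFun ν p (volume (dyadicLevel u k))) ^ p := by
      rw [← ENNReal.mul_rpow_of_nonneg _ _ hp0.le, ENNReal.mul_div_right_comm, mul_assoc]
    simp_rw [h1]
    rw [ENNReal.tsum_mul_left]
    calc _ ≤ (2 / l : ℝ≥0∞) ^ p * (K * nlEnergy ν p univ u) := by gcongr; exact hK u hu hLp
      _ = ((2 * K ^ (1 / p) : ℝ≥0) * nlSeminorm ν p univ u / l) ^ p := by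
          have h2 (x : ℝ≥0∞) : (x ^ (1 / p)) ^ p = x := by
            rw [← ENNReal.rpow_mul, one_div_mul_cancel hp0.ne', ENNReal.rpow_one]
          rw [ENNReal.coe_mul, ENNReal.coe_rpow_of_nonneg _ (by positivity), mul_assoc,
            ENNReal.mul_div_right_comm, ENNReal.mul_rpow_of_nonneg _ _ hp0.le,
            ENNReal.mul_rpow_of_nonneg _ _ hp0.le, nlSeminorm, h2, h2, ENNReal.coe_ofNat]
      _ ≤ 1 := ENNReal.rpow_le_one (ENNReal.div_le_of_le_mul (by simpa using hl.le)) hp0.le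
  refine (lintegral_criticalFun_le_tsum hν hp hu l).trans (le_trans ?_ hsum)
  refine ENNReal.tsum_le_tsum fun k => hν.criticalFun_mul_le hp (hfin k) ?_
  rw [← ENNReal.rpow_le_rpow_iff hp0, ENNReal.one_rpow]
  exact (ENNReal.le_tsum k).trans hsum

variable {Ω : Set (EuclideanSpace ℝ (Fin d))} {u v : EuclideanSpace ℝ (Fin d) → ℝ}

lemma luxNorm_mono_set {φ : ℝ≥0∞ → ℝ≥0∞} :
    luxNorm φ Ω u ≤ luxNorm φ univ u :=
  le_iInf₂ fun l hl => iInf₂_le l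
    ⟨hl.1, (lintegral_mono_set (subset_univ Ω)).trans hl.2⟩

lemma luxNorm_congr {φ : ℝ≥0∞ → ℝ≥0∞} (h : u =ᵐ[volume.restrict Ω] v) :
    luxNorm φ Ω u = luxNorm φ Ω v := by
  unfold luxNorm
  have (l : ℝ≥0) : ∫⁻ x in Ω, φ (‖u x‖ₑ / l) = ∫⁻ x in Ω, φ (‖v x‖ₑ / l) :=
    lintegral_congr_ae (h.mono fun x hx => by simp only [hx])
  simp_rw [this]

lemma nlSeminorm_mono (hp : 1 ≤ p) (h : ∀ x y, |u x - u y| ≤ |v x - v y|) :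
    nlSeminorm ν p Ω u ≤ nlSeminorm ν p Ω v := by
  refine ENNReal.rpow_le_rpow ?_ (by positivity)
  refine lintegral_mono fun x => lintegral_mono fun y => ?_
  gcongr
  exact enorm_le_iff_norm_le.2 (h x y)

lemma nlSeminorm_sub_const (c : ℝ) :
    nlSeminorm ν p Ω (fun x => u x - c) = nlSeminorm ν p Ω u := by
  simp [nlSeminorm, nlEnergy]

lemma eLpNorm_ofReal (hp : 1 ≤ p) (μ : Measure (EuclideanSpace ℝ (Fin d))) :
    eLpNorm u (ENNReal.ofReal p) μ = (∫⁻ x, ‖u x‖ₑ ^ p ∂μ) ^ (1 / p) := by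
  have hp0 : 0 < p := by positivity
  rw [eLpNorm_eq_lintegral_rpow_enorm_toReal (by simpa) (by simp), ENNReal.toReal_ofReal hp0.le]

/-- The embedding `L^φ(Ω) ⊂ L^p(Ω)`, in modular form. -/
lemma setLIntegral_rpow_le (hν : IsAdmissibleKernel ν p) (hp : 1 ≤ p)
    (hu : AEMeasurable u (volume.restrict Ω)) {l : ℝ≥0} (hl : 0 < l) :
    ∫⁻ x in Ω, ‖u x‖ₑ ^ p ≤ (l : ℝ≥0∞) ^ p * (volume Ω +
      (criticalFun ν p 1)⁻¹ * ∫⁻ x in Ω, criticalFun ν p (‖u x‖ₑ / l)) := by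
  have hp0 : 0 < p := by positivity
  have hl0 : (l : ℝ≥0∞) ≠ 0 := by exact_mod_cast hl.ne'
  have hφ0 := hν.criticalFun_ne_zero one_ne_zero
  have hφ1 := hν.criticalFun_ne_top hp ENNReal.one_ne_top
  -- For `t ≥ 1`, convexity compares `φ(1)` with `φ(t)`: `φ(1) ≤ t^{-p} φ(t)`.
  have key (t : ℝ≥0∞) (ht : t ≠ ∞) : t ^ p ≤ 1 + (criticalFun ν p 1)⁻¹ * criticalFun ν p t := by
    rcases le_total t 1 with h | h
    · exact le_add_right (ENNReal.rpow_le_one h hp0.le)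
    · refine le_add_left ?_
      have ht0 : t ≠ 0 := (one_pos.trans_le h).ne'
      have h1 := hν.criticalFun_le_rpow_mul hp h ht
      calc t ^ p = t ^ p * ((criticalFun ν p 1)⁻¹ * criticalFun ν p 1) := by
            rw [ENNReal.inv_mul_cancel hφ0 hφ1, mul_one]
        _ ≤ t ^ p * ((criticalFun ν p 1)⁻¹ * ((1 / t) ^ p * criticalFun ν p t)) := by gcongr
        _ = (t * (1 / t)) ^ p * ((criticalFun ν p 1)⁻¹ * criticalFun ν p t) := by
            rw [ENNReal.mul_rpow_of_nonneg _ _ hp0.le]; ring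
        _ = _ := by rw [ENNReal.mul_div_cancel ht0 ht, ENNReal.one_rpow, one_mul]
  have hm : AEMeasurable (fun x => criticalFun ν p (‖u x‖ₑ / l)) (volume.restrict Ω) :=
    (hν.criticalFun_mono hp).measurable.comp_aemeasurable (hu.enorm.div_const _)
  have hlp : (l : ℝ≥0∞) ^ p ≠ ∞ := ENNReal.rpow_ne_top_of_nonneg hp0.le (by simp)
  calc ∫⁻ x in Ω, ‖u x‖ₑ ^ p ≤ ∫⁻ x in Ω, (l : ℝ≥0∞) ^ p *
        (1 + (criticalFun ν p 1)⁻¹ * criticalFun ν p (‖u x‖ₑ / l)) := by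
        refine lintegral_mono fun x => ?_
        calc ‖u x‖ₑ ^ p = (l : ℝ≥0∞) ^ p * (‖u x‖ₑ / l) ^ p := by
              rw [← ENNReal.mul_rpow_of_nonneg _ _ hp0.le, ENNReal.mul_div_cancel hl0 (by simp)]
          _ ≤ _ := by gcongr; exact key _ (ENNReal.div_ne_top enorm_ne_top hl0)
    _ = _ := by
        rw [lintegral_const_mul' _ _ hlp, lintegral_add_left measurable_const,
          lintegral_const_mul'' _ hm, setLIntegral_one]

lemma eLpNorm_le_luxNorm (hν : IsAdmissibleKernel ν p) (hp : 1 ≤ p) (hΩ : volume Ω ≠ ∞)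
    (hu : AEMeasurable u (volume.restrict Ω)) :
    eLpNorm u (ENNReal.ofReal p) (volume.restrict Ω) ≤
      (volume Ω + (criticalFun ν p 1)⁻¹) ^ (1 / p) * luxNorm (criticalFun ν p) Ω u := by
  have hp0 : 0 < p := by positivity
  set K := (volume Ω + (criticalFun ν p 1)⁻¹) ^ (1 / p) with hK
  have hφ0 := hν.criticalFun_ne_zero one_ne_zero
  have hφ1 := hν.criticalFun_ne_top hp ENNReal.one_ne_top
  have hK0 : K ≠ 0 := by
    refine (ENNReal.rpow_pos ?_ ?_).ne'
    · exact (ENNReal.inv_pos.2 hφ1).trans_le le_add_self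
    · exact ENNReal.add_ne_top.2 ⟨hΩ, ENNReal.inv_ne_top.2 hφ0⟩
  have hK1 : K ≠ ∞ := ENNReal.rpow_ne_top_of_nonneg (by positivity)
    (ENNReal.add_ne_top.2 ⟨hΩ, ENNReal.inv_ne_top.2 hφ0⟩)
  rw [← ENNReal.div_le_iff' hK0 hK1]
  refine le_iInf₂ fun l hl => ?_
  rw [ENNReal.div_le_iff' hK0 hK1, eLpNorm_ofReal hp]
  calc _ ≤ ((l : ℝ≥0∞) ^ p * (volume Ω + (criticalFun ν p 1)⁻¹ * 1)) ^ (1 / p) := by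
        gcongr
        refine (setLIntegral_rpow_le hν hp hu hl.1).trans ?_
        gcongr
        exact hl.2
    _ = K * l := by
        rw [mul_one, ENNReal.mul_rpow_of_nonneg _ _ (by positivity), ← ENNReal.rpow_mul,
          mul_one_div_cancel hp0.ne', ENNReal.rpow_one, mul_comm]

lemma MemOrlicz.memLp (hν : IsAdmissibleKernel ν p) (hp : 1 ≤ p) (hΩ : volume Ω ≠ ∞)
    (hu : MemOrlicz (criticalFun ν p) Ω u) :
    MemLp u (ENNReal.ofReal p) (volume.restrict Ω) := by
  obtain ⟨hm, l, hl, hlt⟩ := hu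
  refine ⟨hm.aestronglyMeasurable, ?_⟩
  rw [eLpNorm_ofReal hp]
  refine ENNReal.rpow_lt_top_of_nonneg (by positivity) ?_
  refine ne_top_of_le_ne_top ?_ (setLIntegral_rpow_le hν hp hm hl)
  refine ENNReal.mul_ne_top (ENNReal.rpow_ne_top_of_nonneg (by positivity) (by simp)) ?_
  refine ENNReal.add_ne_top.2 ⟨hΩ, ENNReal.mul_ne_top (ENNReal.inv_ne_top.2 ?_) hlt.ne⟩
  exact hν.criticalFun_ne_zero one_ne_zero

lemma memOrlicz_of_bounded (hν : IsAdmissibleKernel ν p) (hp : 1 ≤ p) (hΩ : volume Ω ≠ ∞)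
    (hu : AEMeasurable u (volume.restrict Ω)) {c : ℝ} (hc : ∀ x, |u x| ≤ c) :
    MemOrlicz (criticalFun ν p) Ω u := by
  refine ⟨hu, 1, one_pos, ?_⟩
  calc _ ≤ ∫⁻ _ in Ω, criticalFun ν p (ENNReal.ofReal c) := by
        refine lintegral_mono fun x => hν.criticalFun_mono hp ?_
        rw [ENNReal.coe_one, div_one, Real.enorm_eq_ofReal_abs]
        exact ENNReal.ofReal_le_ofReal (hc x)
    _ < ∞ := by
        rw [setLIntegral_const]
        exact ENNReal.mul_lt_top (hν.criticalFun_ne_top hp ENNReal.ofReal_ne_top).lt_top hΩ.lt_top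

theorem PoincareSobolev.poincare (hν : IsAdmissibleKernel ν p) (hp : 1 ≤ p)
    (hΩ : volume Ω ≠ ∞) (h : PoincareSobolev ν p Ω) : Poincare ν p Ω := by
  obtain ⟨C, hC, hPS⟩ := h
  have hφ0 := hν.criticalFun_ne_zero one_ne_zero
  have hφ1 := hν.criticalFun_ne_top hp ENNReal.one_ne_top
  obtain ⟨K, hK⟩ : ∃ K : ℝ≥0, (K : ℝ≥0∞) = (volume Ω + (criticalFun ν p 1)⁻¹) ^ (1 / p) :=
    ⟨_, ENNReal.coe_toNNReal (ENNReal.rpow_ne_top_of_nonneg (by positivity)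
      (ENNReal.add_ne_top.2 ⟨hΩ, ENNReal.inv_ne_top.2 hφ0⟩))⟩
  have hK0 : 0 < K := by
    rw [← ENNReal.coe_pos, hK]
    refine ENNReal.rpow_pos ((ENNReal.inv_pos.2 hφ1).trans_le le_add_self) ?_
    exact ENNReal.add_ne_top.2 ⟨hΩ, ENNReal.inv_ne_top.2 hφ0⟩
  refine ⟨K * C, mul_pos hK0 hC, fun u hu => ?_⟩
  have : IsFiniteMeasure (volume.restrict Ω) := ⟨by simpa using hΩ.lt_top⟩
  have hint : Integrable u (volume.restrict Ω) := hu.integrable (by simpa)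
  -- A function in `L^p` need not lie in `L^φ`, but its truncations do.
  set T : ℕ → EuclideanSpace ℝ (Fin d) → ℝ := fun n x => max (-n) (min n (u x)) with hT
  have hTm (n : ℕ) : AEMeasurable (T n) (volume.restrict Ω) :=
    aemeasurable_const.max (aemeasurable_const.min hu.1.aemeasurable)
  have hTb (n : ℕ) (x) : |T n x| ≤ n := by
    rw [abs_le]
    exact ⟨le_max_left _ _, max_le (by simp) (min_le_left _ _)⟩
  have hclip (n : ℕ) (a b : ℝ) :
      |max (-(n : ℝ)) (min n a) - max (-(n : ℝ)) (min n b)| ≤ |a - b| := by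
    rw [max_comm, max_comm _ (min _ b), min_comm, min_comm _ b]
    exact (abs_max_sub_max_le_abs _ _ _).trans (abs_inf_sub_inf_le_abs _ _ _)
  have hTu (n : ℕ) (x) : |T n x| ≤ |u x| := by simpa using hclip n (u x) 0
  have hTsub (n : ℕ) (x y) : |T n x - T n y| ≤ |u x - u y| := hclip n _ _
  have hTlim (x) : Filter.Tendsto (fun n => T n x) Filter.atTop (nhds (u x)) := by
    obtain ⟨N, hN⟩ := exists_nat_ge |u x|
    refine tendsto_const_nhds.congr' ?_
    filter_upwards [Filter.eventually_ge_atTop N] with n hn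
    have h1 := abs_le.1 (hN.trans (Nat.cast_le.2 hn))
    simp only [hT]
    rw [min_eq_right h1.2, max_eq_right h1.1]
  have havg : Filter.Tendsto (fun n => ⨍ y in Ω, T n y) Filter.atTop (nhds (⨍ y in Ω, u y)) := by
    simp_rw [average_eq]
    refine Filter.Tendsto.const_smul ?_ _
    exact tendsto_integral_of_dominated_convergence (fun x => |u x|)
      (fun n => (hTm n).aestronglyMeasurable) hint.abs
      (fun n => Filter.Eventually.of_forall fun x => hTu n x)
      (Filter.Eventually.of_forall hTlim)
  -- Fatou: the averages converge too, so a bound on each truncation that is uniform in `n` passes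
  -- to `u`.
  refine (Lp.eLpNorm_lim_le_liminf_eLpNorm (f := fun n x => T n x - ⨍ y in Ω, T n y)
    (fun n => ((hTm n).sub_const _).aestronglyMeasurable) _
    (Filter.Eventually.of_forall fun x => (hTlim x).sub havg)).trans ?_
  refine Filter.liminf_le_of_le (by isBoundedDefault) fun b hb => ?_
  obtain ⟨n, hn⟩ := hb.exists
  refine hn.trans ((eLpNorm_le_luxNorm hν hp hΩ ((hTm n).sub_const _)).trans ?_)
  rw [← hK, ENNReal.coe_mul, mul_assoc]
  gcongr
  refine (hPS _ (memOrlicz_of_bounded hν hp hΩ (hTm n) (hTb n))).trans ?_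
  gcongr
  exact nlSeminorm_mono hp (hTsub n)

theorem Poincare.poincareSobolev (hd : 1 ≤ d) (hν : IsAdmissibleKernel ν p) (hp : 1 ≤ p)
    (hΩ : volume Ω ≠ ∞) (hext : IsExtensionDomain ν hν.measurable p hp Ω)
    (h : Poincare ν p Ω) : PoincareSobolev ν p Ω := by
  have hp0 : 0 < p := by positivity
  obtain ⟨-, E, CE, hE⟩ := hext
  obtain ⟨C, hC, hP⟩ := h
  obtain ⟨K, hK⟩ := exists_luxNorm_le_nlSeminorm hd hp hν
  have hr (a : ℝ≥0∞) : (a ^ p) ^ (1 / p) = a := by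
    rw [← ENNReal.rpow_mul, mul_one_div_cancel hp0.ne', ENNReal.rpow_one]
  set R : ℝ≥0 := (C ^ p + 1) ^ (1 / p) with hR
  -- The `+ 1` keeps the constant positive even if `K` or `CE` is `0`, so that its product with an
  -- infinite seminorm is `∞`.
  refine ⟨K * CE * R + 1, by positivity, fun u hu => ?_⟩
  rcases eq_or_ne (nlSeminorm ν p Ω u) ∞ with htop | htop
  · rw [htop, ENNReal.mul_top (by simp)]
    exact le_top
  have : IsFiniteMeasure (volume.restrict Ω) := ⟨by simpa using hΩ.lt_top⟩
  have hmem := hu.memLp hν hp hΩ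
  set f : EuclideanSpace ℝ (Fin d) → ℝ := fun x => u x - ⨍ y in Ω, u y with hf
  have hfmem : MemLp f (ENNReal.ofReal p) (volume.restrict Ω) := hmem.sub (memLp_const _)
  have hfL := hfmem.coeFn_toLp
  have hsemi : nlSeminorm ν p Ω (hfmem.toLp f) = nlSeminorm ν p Ω u := by
    rw [← nlSeminorm_sub_const (u := u), nlSeminorm, nlEnergy_congr ν p Ω hfL]
    rfl
  obtain ⟨hE1, hE2⟩ := hE ⟨hfmem.toLp f, hsemi.trans_lt htop.lt_top⟩
  let g := E ⟨hfmem.toLp f, hsemi.trans_lt htop.lt_top⟩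
  set G : EuclideanSpace ℝ (Fin d) → ℝ :=
    ((g : Lp ℝ (ENNReal.ofReal p) (volume.restrict univ)) : EuclideanSpace ℝ (Fin d) → ℝ) with hG
  have hGint : ∫⁻ x, ‖G x‖ₑ ^ p ≠ ∞ := by
    have h1 : eLpNorm G (ENNReal.ofReal p) (volume.restrict univ) < ∞ := (Lp.memLp g.1).2
    rw [eLpNorm_ofReal hp, ENNReal.rpow_lt_top_iff_of_pos (by positivity),
      ← setLIntegral_univ] at h1
    simpa using h1.ne
  calc luxNorm (criticalFun ν p) Ω f = luxNorm (criticalFun ν p) Ω G :=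
        luxNorm_congr (hfL.symm.trans hE1.symm)
    _ ≤ luxNorm (criticalFun ν p) univ G := luxNorm_mono_set
    _ ≤ K * nlSeminorm ν p univ G := hK G (Lp.stronglyMeasurable _).measurable hGint
    _ ≤ K * nlNorm ν p univ G := by
        gcongr
        rw [nlNorm]
        refine (hr _).symm.trans_le (ENNReal.rpow_le_rpow le_add_self (by positivity))
    _ ≤ K * (CE * nlNorm ν p Ω (hfmem.toLp f)) := by gcongr
    _ ≤ K * (CE * (R * nlSeminorm ν p Ω u)) := by
        gcongr
        rw [nlNorm, hsemi, eLpNorm_congr_ae hfL]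
        calc _ ≤ ((C * nlSeminorm ν p Ω u) ^ p + nlSeminorm ν p Ω u ^ p) ^ (1 / p) := by
              gcongr
              exact hP u hmem
          _ = (((C : ℝ≥0∞) ^ p + 1) * nlSeminorm ν p Ω u ^ p) ^ (1 / p) := by
              rw [ENNReal.mul_rpow_of_nonneg _ _ hp0.le, add_mul, one_mul]
          _ = R * nlSeminorm ν p Ω u := by
              rw [ENNReal.mul_rpow_of_nonneg _ _ (by positivity), hr, hR,
                ENNReal.coe_rpow_of_nonneg _ (by positivity), ENNReal.coe_add,
                ENNReal.coe_rpow_of_nonneg _ hp0.le, ENNReal.coe_one]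
    _ ≤ (K * CE * R + 1 : ℝ≥0) * nlSeminorm ν p Ω u := by
        push_cast
        rw [← mul_assoc, ← mul_assoc]
        gcongr
        exact le_self_add

end Inequalities

end NonlocalSobolev

theorem mainTheorem4 (d : ℕ) (hd : 1 ≤ d) (p : ℝ) (hp : 1 ≤ p)
    (ν : EuclideanSpace ℝ (Fin d) → ℝ≥0∞) (hν : NonlocalSobolev.IsAdmissibleKernel ν p)
    (Ω : Set (EuclideanSpace ℝ (Fin d))) (hΩ : MeasurableSet Ω)
    (hΩ_pos : 0 < volume Ω) (hΩ_fin : volume Ω < ∞) :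
    (NonlocalSobolev.PoincareSobolev ν p Ω → NonlocalSobolev.Poincare ν p Ω) ∧
    (NonlocalSobolev.IsExtensionDomain ν hν.measurable p hp Ω →
      NonlocalSobolev.Poincare ν p Ω → NonlocalSobolev.PoincareSobolev ν p Ω) := by
  exact ⟨fun h => h.poincare hν hp hΩ_fin.ne, fun hext h =>
    h.poincareSobolev hd hν hp hΩ_fin.ne hext⟩
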